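/- For a topological space $Y$, an abelian group $G$ and $n\ge 0$, let $H^n(Y;G)$ denote Alexander–Spanier cohomology: the $n$-th cohomology of the complex of all functions $\varphi:Y^{n+1}\to G$ modulo the locally zero ones (those $\varphi$ for which every point of $Y$ has a neighbourhood $U$ with $\varphi=0$ on $U^{n+1}$), with the coboundary $(\delta\varphi)(y_0,\dots,y_{n+1})=\sum_{i=0}^{n+1}(-1)^i\varphi(y_0,\dots,\widehat{y_i},\dots,y_{n+1})$. For paracompact Hausdorff spaces this agrees with Čech cohomology. **Theorem.** Let $p$ be a prime and let $\mathbb Z_p$ be the field with $p$ elements. There exist locally compact connected Hausdorff spaces $X$ and $T$ and points $r,s\in T$ such that the embeddings $F_r,F_s:X\to X\times T$, $F_r(x)=(x,r)$ and $F_s(x)=(x,s)$, induce different homomorphisms $H^n(X\times T;\mathbb Z_p)\to H^n(X;\mathbb Z_p)$ for some $n$. Explicitly, one may take $n=1$ and, with the subspace topology of the plane, $$X=T=\{(x,y)\in\mathbb R^2 : 0<x\le 1,\ y=\sin(1/x)\}\ \cup\ \{(0,y) : -1\le y<0\},\qquad r=(0,-1),\quad s=(1,\sin 1):$$ the space $T$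 is locally compact and connected, and $F_r^*\ne F_s^*: H^1(T\times T;\mathbb Z_p)\to H^1(T;\mathbb Z_p)$. -/

import Mathlib

open scoped Topology

namespace AlexanderSpanier

universe u v w

section Complex

variable (X : Type u) [TopologicalSpace X] (G : Type w) [AddCommGroup G]

/-- All functions from `(n+1)`-tuples of points of `X` to `G`, with no continuity required. -/
abbrev Cochain (X : Type u) (G : Type w) (n : ℕ) : Type (max u w) := (Fin (n + 1) → X) → G

/-- The coboundary `(δφ)(x₀,…,x_{n+1}) = ∑ᵢ (-1)ⁱ φ(x₀,…,x̂ᵢ,…,x_{n+1})`. -/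
def delta (X : Type u) (G : Type w) [AddCommGroup G] (n : ℕ) :
    Cochain X G n →+ Cochain X G (n + 1) where
  toFun φ := fun x => ∑ i : Fin (n + 2), (-1 : ℤ) ^ (i : ℕ) • φ (fun j => x (i.succAbove j))
  map_zero' := by
    funext x
    simp
  map_add' φ ψ := by
    funext x
    simp [Finset.sum_add_distrib]

/-- The locally zero cochains: those for which every point has a neighbourhood `U` such that the
cochain vanishes on all tuples of points of `U` (equivalently, there is an open cover such that
the cochain vanishes on all tuples lying in one member of the cover). -/
def locallyZero (n : ℕ) : AddSubgroup (Cochain X G n) where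
  carrier := {φ | ∀ a : X, ∃ U ∈ 𝓝 a, ∀ x : Fin (n + 1) → X, (∀ i, x i ∈ U) → φ x = 0}
  zero_mem' := fun _ => ⟨Set.univ, Filter.univ_mem, fun _ _ => rfl⟩
  add_mem' := by
    intro φ ψ hφ hψ a
    obtain ⟨U, hU, hU0⟩ := hφ a
    obtain ⟨V, hV, hV0⟩ := hψ a
    refine ⟨U ∩ V, Filter.inter_mem hU hV, fun x hx => ?_⟩
    rw [Pi.add_apply, hU0 x (fun i => (hx i).1), hV0 x (fun i => (hx i).2), add_zero]
  neg_mem' := by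
    intro φ hφ a
    obtain ⟨U, hU, hU0⟩ := hφ a
    refine ⟨U, hU, fun x hx => ?_⟩
    rw [Pi.neg_apply, hU0 x hx, neg_zero]

theorem delta_mem_locallyZero (n : ℕ) :
    locallyZero X G n ≤ (locallyZero X G (n + 1)).comap (delta X G n) := by
  intro φ hφ a
  obtain ⟨U, hU, hU0⟩ := hφ a
  refine ⟨U, hU, fun x hx => ?_⟩
  change ∑ i : Fin (n + 2), (-1 : ℤ) ^ (i : ℕ) • φ (fun j => x (i.succAbove j)) = 0
  refine Finset.sum_eq_zero fun i _ => ?_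
  rw [hU0 _ (fun j => hx (i.succAbove j)), smul_zero]

/-- The Alexander–Spanier cochains: all cochains modulo the locally zero ones. -/
abbrev QuotCochain (n : ℕ) : Type (max u w) := Cochain X G n ⧸ locallyZero X G n

/-- The coboundary on the Alexander–Spanier cochain complex. -/
def dbar (n : ℕ) : QuotCochain X G n →+ QuotCochain X G (n + 1) :=
  QuotientAddGroup.map (locallyZero X G n) (locallyZero X G (n + 1)) (delta X G n)
    (delta_mem_locallyZero X G n)

/-- The cocycles of degree `n`. -/
def cocycles (n : ℕ) : AddSubgroup (QuotCochain X G n) := (dbar X G n).ker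

/-- The coboundaries of degree `n`; only zero is a coboundary in degree `0`. -/
def coboundaries : (n : ℕ) → AddSubgroup (QuotCochain X G n)
  | 0 => ⊥
  | n + 1 => (dbar X G n).range

/-- Alexander–Spanier cohomology `Hⁿ(X; G)`: cocycles modulo coboundaries. -/
abbrev H (n : ℕ) : Type (max u w) :=
  cocycles X G n ⧸ (coboundaries X G n).addSubgroupOf (cocycles X G n)

end Complex

section Functoriality

variable {X : Type u} [TopologicalSpace X] {Y : Type v} [TopologicalSpace Y]
  (G : Type w) [AddCommGroup G] (f : C(X, Y))

/-- Pull-back of cochains: `(f^# φ)(x₀,…,xₙ) = φ(f x₀,…,f xₙ)`. -/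
def pullback (n : ℕ) : Cochain Y G n →+ Cochain X G n where
  toFun φ := fun x => φ (fun i => f (x i))
  map_zero' := rfl
  map_add' _ _ := rfl

theorem pullback_mem_locallyZero (n : ℕ) :
    locallyZero Y G n ≤ (locallyZero X G n).comap (pullback G f n) := by
  intro φ hφ a
  obtain ⟨U, hU, hU0⟩ := hφ (f a)
  exact ⟨f ⁻¹' U, f.continuous.continuousAt hU, fun x hx => hU0 _ hx⟩

/-- Pull-back of Alexander–Spanier cochains. -/
def quotPullback (n : ℕ) : QuotCochain Y G n →+ QuotCochain X G n :=
  QuotientAddGroup.map (locallyZero Y G n) (locallyZero X G n) (pullback G f n)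
    (pullback_mem_locallyZero G f n)

theorem dbar_quotPullback (n : ℕ) (c : QuotCochain Y G n) :
    dbar X G n (quotPullback G f n c) = quotPullback G f (n + 1) (dbar Y G n c) := by
  induction c using QuotientAddGroup.induction_on with
  | H φ => rfl

theorem quotPullback_mem_cocycles (n : ℕ) (c : cocycles Y G n) :
    quotPullback G f n c ∈ cocycles X G n := by
  have hc : dbar Y G n c = 0 := c.2
  change dbar X G n (quotPullback G f n c) = 0
  rw [dbar_quotPullback, hc, map_zero]

theorem quotPullback_mem_coboundaries (n : ℕ) (c : QuotCochain Y G n)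
    (hc : c ∈ coboundaries Y G n) : quotPullback G f n c ∈ coboundaries X G n := by
  cases n with
  | zero =>
    have hc0 : c = 0 := hc
    rw [hc0, map_zero]
    exact zero_mem _
  | succ n =>
    obtain ⟨b, rfl⟩ := hc
    exact ⟨quotPullback G f n b, dbar_quotPullback G f n b⟩

/-- Pull-back of cocycles. -/
def cocyclesMap (n : ℕ) : cocycles Y G n →+ cocycles X G n :=
  ((quotPullback G f n).comp (cocycles Y G n).subtype).codRestrict (cocycles X G n)
    (quotPullback_mem_cocycles G f n)

/-- The homomorphism `f* : Hⁿ(Y; G) → Hⁿ(X; G)` induced by a continuous map `f : X → Y`. -/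
def H.map (n : ℕ) : H Y G n →+ H X G n :=
  QuotientAddGroup.map _ _ (cocyclesMap G f n)
    (fun c hc => quotPullback_mem_coboundaries G f n c hc)

end Functoriality

end AlexanderSpanier

/-- The slice embedding `F_t : X → X × T`, `x ↦ (x, t)`. -/
def sliceEmbedding (X : Type*) {T : Type*} [TopologicalSpace X] [TopologicalSpace T] (t : T) :
    C(X, X × T) :=
  (ContinuousMap.id X).prodMk (ContinuousMap.const X t)

/-- The modified topologist's sine curve: the graph of `sin (1/x)` over `0 < x ≤ 1` together with
the half-open segment `{0} × [-1, 0)`, with the subspace topology of the plane. -/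
def modifiedSineCurve : Set (ℝ × ℝ) :=
  {q | (0 < q.1 ∧ q.1 ≤ 1 ∧ q.2 = Real.sin (1 / q.1)) ∨ (q.1 = 0 ∧ -1 ≤ q.2 ∧ q.2 < 0)}

/-- The point `(0, -1)` of the modified sine curve. -/
def rPoint : modifiedSineCurve :=
  ⟨(0, -1), Or.inr ⟨rfl, le_refl _, by norm_num⟩⟩

/-- The point `(1, sin 1)` of the modified sine curve. -/
noncomputable def sPoint : modifiedSineCurve :=
  ⟨(1, Real.sin 1), Or.inl ⟨one_pos, le_refl _, by norm_num⟩⟩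

/-! Give a graph point a height that climbs by one over each peak, is constant on each valley, and
tends to infinity towards the limit segment. `minHeight` is the smaller height of a pair in T × T.
It is continuous off segment × segment. Near that product both points lie in valleys or on the
segment, so its values are integers. Hence it is continuous modulo ℤ
(`nearlyContinuousModInt_minHeight`), and rounding its differences gives a 1-cocycle, the class of a
map to the circle. On the slice at s, a point of least height, `minHeight` is constant and the class
dies. On the slice at r it is the height itself. A primitive of the cocycle would be constant along
the graph, yet near r it would change by 1 between the bottoms of consecutive valleys
(`map_rPoint_minHeightClass_ne_zero`). Only 1 ≠ 0 in the coefficients is needed. -/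

namespace AlexanderSpanier

/-! ### Cocycles from functions continuous modulo ℤ -/

section RoundingCocycle

variable {Y : Type*} [TopologicalSpace Y]

/-- The `1`-cochain sending `(y₀, y₁)` to the integer nearest to `l y₁ - l y₀`. -/
noncomputable def roundCochain (G : Type*) [AddGroupWithOne G] (l : Y → ℝ) : Cochain Y G 1 :=
  fun y => ((round (l (y 1) - l (y 0)) : ℤ) : G)

/-- `l` is continuous modulo `ℤ`, up to an error less than `1 / 4`. -/
def NearlyContinuousModInt (l : Y → ℝ) : Prop :=
  ∀ a, ∀ᶠ b in 𝓝 a, ∃ n : ℤ, |l b - l a - n| < 1 / 4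

theorem round_eq_of_abs_sub_lt {x : ℝ} {n : ℤ} (h : |x - n| < 1 / 2) : round x = n := by
  rw [abs_lt] at h
  rw [round_eq, Int.floor_eq_iff]
  constructor <;> linarith [h.1, h.2]

/-- Near a point, each value of `l` is within 1/4 of a common real plus an integer `n i`.
Differences then round exactly to `n j - n i`, whose alternating sum cancels. -/
theorem delta_roundCochain_mem_locallyZero (G : Type*) [AddCommGroupWithOne G] {l : Y → ℝ}
    (hl : NearlyContinuousModInt l) :
    delta Y G 1 (roundCochain G l) ∈ locallyZero Y G 2 := by
  intro a
  refine ⟨_, hl a, fun y hy => ?_⟩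
  choose n hn using hy
  have key : ∀ i j, round (l (y j) - l (y i)) = n j - n i := fun i j => by
    apply round_eq_of_abs_sub_lt
    have hi := abs_lt.1 (hn i)
    have hj := abs_lt.1 (hn j)
    rw [abs_lt]
    push_cast
    constructor <;> linarith [hi.1, hi.2, hj.1, hj.2]
  change ∑ i : Fin 3, (-1 : ℤ) ^ (i : ℕ) • roundCochain G l (fun j => y (i.succAbove j)) = 0
  have e0 : roundCochain G l (fun j => y ((0 : Fin 3).succAbove j)) = ((n 2 - n 1 : ℤ) : G) :=
    congrArg _ (key 1 2)
  have e1 : roundCochain G l (fun j => y ((1 : Fin 3).succAbove j)) = ((n 2 - n 0 : ℤ) : G) :=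
    congrArg _ (key 0 2)
  have e2 : roundCochain G l (fun j => y ((2 : Fin 3).succAbove j)) = ((n 1 - n 0 : ℤ) : G) :=
    congrArg _ (key 0 1)
  rw [Fin.sum_univ_three, e0, e1, e2]
  simp

/-- The Alexander–Spanier cohomology class of a cochain with locally zero coboundary. -/
def cohomologyClass {G : Type*} [AddCommGroup G] {n : ℕ} (φ : Cochain Y G n)
    (hφ : delta Y G n φ ∈ locallyZero Y G (n + 1)) : H Y G n :=
  QuotientAddGroup.mk ⟨QuotientAddGroup.mk φ, (QuotientAddGroup.eq_zero_iff _).2 hφ⟩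

theorem map_cohomologyClass_eq_zero_iff {X G : Type*} [TopologicalSpace X] [AddCommGroup G]
    (f : C(X, Y)) {n : ℕ} (φ : Cochain Y G (n + 1))
    (hφ : delta Y G (n + 1) φ ∈ locallyZero Y G (n + 2)) :
    H.map G f (n + 1) (cohomologyClass φ hφ) = 0 ↔
      ∃ ψ : Cochain X G n, -delta X G n ψ + pullback G f (n + 1) φ ∈ locallyZero X G (n + 1) := by
  have h1 : H.map G f (n + 1) (cohomologyClass φ hφ) = 0 ↔
      (QuotientAddGroup.mk (pullback G f (n + 1) φ) : QuotCochain X G (n + 1)) ∈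
        coboundaries X G (n + 1) :=
    QuotientAddGroup.eq_zero_iff (N := (coboundaries X G (n + 1)).addSubgroupOf _)
      (cocyclesMap G f (n + 1)
        ⟨QuotientAddGroup.mk φ, (QuotientAddGroup.eq_zero_iff _).2 hφ⟩)
  rw [h1]
  constructor
  · rintro ⟨c, hc⟩
    induction c using QuotientAddGroup.induction_on with
    | H ψ => exact ⟨ψ, QuotientAddGroup.eq.1 hc⟩
  · rintro ⟨ψ, hψ⟩
    exact ⟨QuotientAddGroup.mk ψ, QuotientAddGroup.eq.2 hψ⟩

theorem map_cohomologyClass_roundCochain_eq_zero {X G : Type*} [TopologicalSpace X]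
    [AddCommGroupWithOne G] (f : C(X, Y)) {l : Y → ℝ} (hl : NearlyContinuousModInt l)
    (hc : ∀ a b, l (f a) = l (f b)) :
    H.map G f 1 (cohomologyClass _ (delta_roundCochain_mem_locallyZero G hl)) = 0 := by
  rw [map_cohomologyClass_eq_zero_iff]
  refine ⟨0, ?_⟩
  have : pullback G f 1 (roundCochain G l) = 0 := by
    funext y
    change ((round (l (f (y 1)) - l (f (y 0))) : ℤ) : G) = 0
    simp [hc (y 1) (y 0)]
  rw [this, map_zero, neg_zero]
  exact add_mem (zero_mem _) (zero_mem _)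

end RoundingCocycle

end AlexanderSpanier

/-! ### The height function along the graph -/

open Filter

/-- A continuous nondecreasing staircase: it climbs from `n` to `n + 1` over `[n, n + 1/2]` and
is constant on `[n + 1/2, n + 1]`, for each integer `n`. -/
noncomputable def staircase (v : ℝ) : ℝ := v + (min (2 * Int.fract v) 1 - Int.fract v)

theorem staircase_eq (v : ℝ) : staircase v = ⌊v⌋ + min (2 * Int.fract v) 1 := by
  have := Int.floor_add_fract v
  rw [staircase]
  linarith

/-- The periodic correction to the identity takes the same value 0 at both ends of the unit
interval. -/
theorem continuous_staircase : Continuous staircase := by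
  refine continuous_id.add ?_
  refine ContinuousOn.comp_fract'' (f := fun x : ℝ => min (2 * x) 1 - x) ?_ ?_
  · fun_prop
  · norm_num

theorem le_staircase (v : ℝ) : v ≤ staircase v := by
  rw [staircase]
  have h0 := Int.fract_nonneg v
  have h1 := Int.fract_lt_one v
  have : Int.fract v ≤ min (2 * Int.fract v) 1 := le_min (by linarith) h1.le
  linarith

theorem staircase_mono : Monotone staircase := by
  intro v w h
  rw [staircase_eq, staircase_eq]
  rcases (Int.floor_mono h).eq_or_lt with h' | h'
  · have hv := Int.floor_add_fract v
    have hw := Int.floor_add_fract w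
    have hf : Int.fract v ≤ Int.fract w := by rw [h'] at hv; linarith
    rw [h']
    gcongr
  · have h1 : ((⌊v⌋ + 1 : ℤ) : ℝ) ≤ ⌊w⌋ := by exact_mod_cast h'
    push_cast at h1
    have h2 : min (2 * Int.fract v) 1 ≤ 1 := min_le_right _ _
    have h3 : 0 ≤ min (2 * Int.fract w) 1 :=
      le_min (by linarith [Int.fract_nonneg w]) zero_le_one
    linarith

theorem staircase_of_half_le_fract {v : ℝ} (h : 1 / 2 ≤ Int.fract v) :
    staircase v = (⌊v⌋ + 1 : ℤ) := by
  rw [staircase_eq, min_eq_right (by linarith)]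
  push_cast
  rfl

/-- Valleys sit over the flat halves of the staircase, which is why heights there are integers. -/
theorem half_le_fract_of_sin_neg {u : ℝ} (h : Real.sin u < 0) :
    1 / 2 ≤ Int.fract (u / (2 * Real.pi)) := by
  by_contra! hlt
  have hpi := Real.pi_pos
  set v := u / (2 * Real.pi) with hv
  have hu : u = 2 * Real.pi * Int.fract v + ⌊v⌋ * (2 * Real.pi) := by
    have : u = 2 * Real.pi * v := by rw [hv]; field_simp
    rw [this]
    nth_rewrite 1 [← Int.floor_add_fract v]
    ring
  rw [hu, Real.sin_add_int_mul_two_pi] at h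
  have h0 := Int.fract_nonneg v
  exact absurd h (not_lt.2 (Real.sin_nonneg_of_nonneg_of_le_pi (by positivity) (by nlinarith)))

/-- The height along the graph part of the sine curve: it is constant on every valley, and climbs
by one over every peak. -/
noncomputable def curveHeight (x : ℝ) : ℝ := staircase (1 / x / (2 * Real.pi))

theorem continuousAt_curveHeight {x : ℝ} (hx : x ≠ 0) : ContinuousAt curveHeight x := by
  refine continuous_staircase.continuousAt.comp ?_
  fun_prop (disch := assumption)

theorem tendsto_curveHeight : Tendsto curveHeight (𝓝[>] 0) atTop := by
  refine tendsto_atTop_mono (fun x => le_staircase _) ?_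
  simp only [one_div]
  exact tendsto_inv_nhdsGT_zero.atTop_div_const (by positivity)

theorem curveHeight_one_le {x : ℝ} (h0 : 0 < x) (h1 : x ≤ 1) : curveHeight 1 ≤ curveHeight x := by
  apply staircase_mono
  gcongr

theorem exists_curveHeight_eq_int {x : ℝ} (h : Real.sin (1 / x) < 0) :
    ∃ n : ℤ, curveHeight x = n :=
  ⟨_, staircase_of_half_le_fract (half_le_fract_of_sin_neg h)⟩

/-! ### The minimum of two heights, modulo ℤ -/

namespace modifiedSineCurve

local notation "T" => modifiedSineCurve

theorem fst_nonneg (a : T) : 0 ≤ a.1.1 := by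
  rcases a.2 with h | h
  · exact h.1.le
  · exact h.1.ge

theorem fst_le_one (a : T) : a.1.1 ≤ 1 := by
  rcases a.2 with h | h
  · exact h.2.1
  · rw [h.1]; exact zero_le_one

theorem snd_eq {a : T} (h : 0 < a.1.1) : a.1.2 = Real.sin (1 / a.1.1) := by
  rcases a.2 with h' | h'
  · exact h'.2.2
  · exact absurd h'.1 h.ne'

theorem snd_neg {a : T} (h : a.1.1 = 0) : a.1.2 < 0 := by
  rcases a.2 with h' | h'
  · exact absurd h h'.1.ne'
  · exact h'.2.2

theorem continuous_fst : Continuous fun a : T => a.1.1 := by fun_prop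

theorem continuous_snd : Continuous fun a : T => a.1.2 := by fun_prop

/-- The minimum of the heights of two points of the curve, where the points of the limit segment
have infinite height (and `0` replaces the minimum of two infinite heights). -/
noncomputable def minHeight (q : T × T) : ℝ :=
  if q.1.1.1 = 0 then if q.2.1.1 = 0 then 0 else curveHeight q.2.1.1
  else if q.2.1.1 = 0 then curveHeight q.1.1.1
  else min (curveHeight q.1.1.1) (curveHeight q.2.1.1)

theorem minHeight_swap (q : T × T) : minHeight q.swap = minHeight q := by
  simp only [minHeight, Prod.fst_swap, Prod.snd_swap]
  split_ifs <;> first | rfl | exact min_comm _ _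

/-- Near `a` the first point is on the segment or higher than the second, so the minimum is the
second height. -/
theorem continuousAt_minHeight_of_eq_zero {a : T × T} (h1 : a.1.1.1 = 0) (h2 : 0 < a.2.1.1) :
    ContinuousAt minHeight a := by
  have hc : ContinuousAt (fun q : T × T => curveHeight q.2.1.1) a :=
    (continuousAt_curveHeight h2.ne').comp
      (f := fun q : T × T => q.2.1.1) (continuous_fst.comp _root_.continuous_snd).continuousAt
  refine hc.congr ?_
  have e1 : ∀ᶠ q : T × T in 𝓝 a, curveHeight q.2.1.1 < curveHeight a.2.1.1 + 1 :=
    hc.eventually_lt_const (by linarith)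
  have e2 : ∀ᶠ q : T × T in 𝓝 a, 0 < q.2.1.1 :=
    (continuous_fst.comp _root_.continuous_snd).continuousAt.eventually_const_lt h2
  have e3 : ∀ᶠ q : T × T in 𝓝 a, 0 < q.1.1.1 → curveHeight a.2.1.1 + 1 ≤ curveHeight q.1.1.1 := by
    have ht : Tendsto (fun q : T × T => q.1.1.1) (𝓝 a) (𝓝 0) := by
      have := (continuous_fst.comp _root_.continuous_fst).tendsto a
      simpa only [Function.comp_def, h1] using this
    exact ht.eventually (eventually_nhdsWithin_iff.1 (tendsto_curveHeight.eventually_ge_atTop _))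
  filter_upwards [e1, e2, e3] with q hq1 hq2 hq3
  rw [minHeight]
  rcases (fst_nonneg q.1).eq_or_lt with h | h
  · rw [if_pos h.symm, if_neg hq2.ne']
  · rw [if_neg h.ne', if_neg hq2.ne', min_eq_right]
    linarith [hq3 h]

theorem continuousAt_minHeight {a : T × T} (h : 0 < a.1.1.1 ∨ 0 < a.2.1.1) :
    ContinuousAt minHeight a := by
  rcases (fst_nonneg a.1).eq_or_lt with h1 | h1
  · exact continuousAt_minHeight_of_eq_zero h1.symm (h.resolve_left (by simp [← h1]))
  rcases (fst_nonneg a.2).eq_or_lt with h2 | h2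
  · have := (continuousAt_minHeight_of_eq_zero (a := a.swap) h2.symm h1).comp
      (f := Prod.swap) (x := a) continuous_swap.continuousAt
    exact this.congr (Eventually.of_forall minHeight_swap)
  · have c1 : ContinuousAt (fun q : T × T => q.1.1.1) a :=
      (continuous_fst.comp _root_.continuous_fst).continuousAt
    have c2 : ContinuousAt (fun q : T × T => q.2.1.1) a :=
      (continuous_fst.comp _root_.continuous_snd).continuousAt
    have hc : ContinuousAt (fun q : T × T => min (curveHeight q.1.1.1) (curveHeight q.2.1.1)) a :=
      ((continuousAt_curveHeight h1.ne').comp (f := fun q : T × T => q.1.1.1) c1).min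
        ((continuousAt_curveHeight h2.ne').comp (f := fun q : T × T => q.2.1.1) c2)
    refine hc.congr ?_
    filter_upwards [c1.eventually_const_lt h1, c2.eventually_const_lt h2] with q hq1 hq2
    rw [minHeight, if_neg hq1.ne', if_neg hq2.ne']

theorem exists_minHeight_eq_int {q : T × T} (h1 : q.1.1.2 < 0) (h2 : q.2.1.2 < 0) :
    ∃ n : ℤ, minHeight q = n := by
  have key : ∀ a : T, a.1.2 < 0 → a.1.1 ≠ 0 → ∃ n : ℤ, curveHeight a.1.1 = n := by
    intro a ha h0
    rw [snd_eq ((fst_nonneg a).lt_of_ne' h0)] at ha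
    exact exists_curveHeight_eq_int ha
  rw [minHeight]
  split_ifs with h h' h'
  -- The default value for two segment points matters only through being an integer.
  · exact ⟨0, by simp⟩
  · exact key _ h2 h'
  · exact key _ h1 h
  · obtain ⟨m, hm⟩ := key _ h1 h
    obtain ⟨n, hn⟩ := key _ h2 h'
    exact ⟨min m n, by rw [hm, hn, Int.cast_min]⟩

theorem nearlyContinuousModInt_minHeight :
    AlexanderSpanier.NearlyContinuousModInt minHeight := by
  intro a
  by_cases h : 0 < a.1.1.1 ∨ 0 < a.2.1.1
  · have := Metric.continuousAt_iff'.1 (continuousAt_minHeight h) (1 / 4) (by norm_num)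
    filter_upwards [this] with b hb
    exact ⟨0, by simpa [Real.dist_eq] using hb⟩
  · push Not at h
    have h1 := le_antisymm h.1 (fst_nonneg _)
    have h2 := le_antisymm h.2 (fst_nonneg _)
    have e1 : ∀ᶠ q : T × T in 𝓝 a, q.1.1.2 < 0 :=
      (continuous_snd.comp _root_.continuous_fst).continuousAt.eventually_lt_const (snd_neg h1)
    have e2 : ∀ᶠ q : T × T in 𝓝 a, q.2.1.2 < 0 :=
      (continuous_snd.comp _root_.continuous_snd).continuousAt.eventually_lt_const (snd_neg h2)
    filter_upwards [e1, e2] with q hq1 hq2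
    obtain ⟨n, hn⟩ := exists_minHeight_eq_int hq1 hq2
    exact ⟨n, by rw [hn]; simp [minHeight, h1, h2]⟩

theorem minHeight_sPoint (a : T) : minHeight (a, sPoint) = curveHeight 1 := by
  have hs : (sPoint : T).1.1 = 1 := rfl
  rw [minHeight]
  simp only [hs, one_ne_zero, if_false]
  split_ifs with h
  · rfl
  · exact min_eq_right (curveHeight_one_le ((fst_nonneg a).lt_of_ne' h) (fst_le_one a))

theorem minHeight_rPoint {a : T} (h : 0 < a.1.1) :
    minHeight (a, rPoint) = curveHeight a.1.1 := by
  have hr : (rPoint : T).1.1 = 0 := rfl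
  simp [minHeight, hr, h.ne']

/-! ### Connectedness and local compactness -/

/-- The parametrization of the graph part of the curve by `(0, 1]`. -/
noncomputable def graphPoint (x : Set.Ioc (0 : ℝ) 1) : T :=
  ⟨(x, Real.sin (1 / x)), Or.inl ⟨x.2.1, x.2.2, rfl⟩⟩

theorem minHeight_graphPoint_rPoint (x : Set.Ioc (0 : ℝ) 1) :
    minHeight (graphPoint x, rPoint) = curveHeight x :=
  minHeight_rPoint (a := graphPoint x) x.2.1

theorem continuous_graphPoint : Continuous graphPoint := by
  refine Continuous.subtype_mk ?_ _
  have : ∀ x : Set.Ioc (0 : ℝ) 1, (x : ℝ) ≠ 0 := fun x => x.2.1.ne'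
  fun_prop (disch := assumption)

/-- The parameter `1 / (c + 2 π (n + 1))`, at which the graph has height `sin c`. -/
noncomputable def param (c : ℝ) (hc : -(Real.pi / 2) ≤ c) (n : ℕ) : Set.Ioc (0 : ℝ) 1 :=
  ⟨1 / (c + (n + 1 : ℕ) * (2 * Real.pi)), by
    have hpi := Real.pi_gt_three
    -- Shifting by n + 1 periods keeps this bound even for c = -π/2 and n = 0.
    have h : 1 ≤ c + (n + 1 : ℕ) * (2 * Real.pi) := by
      have : (0 : ℝ) ≤ n * Real.pi := by positivity
      push_cast
      nlinarith
    exact ⟨by positivity, by rw [div_le_one (by linarith)]; exact h⟩⟩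

theorem graphPoint_param (c : ℝ) (hc : -(Real.pi / 2) ≤ c) (n : ℕ) :
    (graphPoint (param c hc n)).1 = ((param c hc n : ℝ), Real.sin c) := by
  simp only [graphPoint, param, one_div_one_div, Real.sin_add_nat_mul_two_pi]

theorem tendsto_param (c : ℝ) (hc : -(Real.pi / 2) ≤ c) :
    Tendsto (fun n => (param c hc n : ℝ)) atTop (𝓝 0) := by
  simp only [param, one_div]
  refine tendsto_inv_atTop_zero.comp (tendsto_atTop_add_const_left _ _ ?_)
  exact (tendsto_natCast_atTop_atTop.comp (tendsto_add_atTop_nat 1)).atTop_mul_const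
    (by positivity)

theorem tendsto_graphPoint_param {a : T} (h : a.1.1 = 0) (c : ℝ) (hc : -(Real.pi / 2) ≤ c)
    (hs : Real.sin c = a.1.2) :
    Tendsto (fun n => graphPoint (param c hc n)) atTop (𝓝 a) := by
  rw [tendsto_subtype_rng]
  simp only [graphPoint_param]
  have : a.1 = (0, Real.sin c) := Prod.ext h hs.symm
  rw [this]
  exact (tendsto_param c hc).prodMk_nhds tendsto_const_nhds

theorem denseRange_graphPoint : DenseRange graphPoint := by
  intro a
  rcases (fst_nonneg a).eq_or_lt with h | h
  · have hb : -1 ≤ a.1.2 := by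
      rcases a.2 with h' | h'
      · exact absurd h h'.1.ne
      · exact h'.2.1
    exact mem_closure_of_tendsto
      (tendsto_graphPoint_param h.symm (Real.arcsin a.1.2) (Real.neg_pi_div_two_le_arcsin _)
        (Real.sin_arcsin hb ((snd_neg h.symm).le.trans zero_le_one)))
      (Eventually.of_forall fun n => Set.mem_range_self _)
  · exact subset_closure ⟨⟨a.1.1, h, fst_le_one a⟩, Subtype.ext (Prod.ext rfl (snd_eq h).symm)⟩

instance : PreconnectedSpace (Set.Ioc (0 : ℝ) 1) :=
  Subtype.preconnectedSpace isPreconnected_Ioc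

instance : ConnectedSpace T :=
  haveI : PreconnectedSpace T := denseRange_graphPoint.preconnectedSpace continuous_graphPoint
  ⟨⟨rPoint⟩⟩

theorem continuous_mul_sin_one_div : Continuous fun x : ℝ => x * Real.sin (1 / x) := by
  rw [continuous_iff_continuousAt]
  intro x
  rcases eq_or_ne x 0 with rfl | hx
  · rw [ContinuousAt, zero_mul]
    refine squeeze_zero_norm (a := fun x : ℝ => ‖x‖) (fun x => ?_) ?_
    · rw [norm_mul]
      exact mul_le_of_le_one_right (norm_nonneg _) (Real.abs_sin_le_one _)
    · exact tendsto_norm_zero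
  · fun_prop (disch := assumption)

theorem isLocallyClosed : IsLocallyClosed T := by
  -- Multiplying the graph equation by x makes it a closed condition, vacuous at x = 0. The open set
  -- then cuts the vertical line down to y < 0.
  refine ⟨{q | 0 < q.1 ∨ q.2 < 0},
    {q | q.1 ∈ Set.Icc (0 : ℝ) 1 ∧ -1 ≤ q.2 ∧ q.1 * q.2 = q.1 * Real.sin (1 / q.1)}, ?_, ?_, ?_⟩
  · exact (isOpen_lt continuous_const _root_.continuous_fst).union
      (isOpen_lt _root_.continuous_snd continuous_const)
  · exact (isClosed_Icc.preimage _root_.continuous_fst).inter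
      ((isClosed_le continuous_const _root_.continuous_snd).inter
        (isClosed_eq (by fun_prop) (continuous_mul_sin_one_div.comp _root_.continuous_fst)))
  · ext ⟨x, y⟩
    simp only [modifiedSineCurve, Set.mem_ofPred_eq, Set.mem_inter_iff, Set.mem_Icc]
    constructor
    · rintro (⟨h0, h1, rfl⟩ | ⟨rfl, h1, h2⟩)
      · exact ⟨Or.inl h0, ⟨h0.le, h1⟩, Real.neg_one_le_sin _, rfl⟩
      · exact ⟨Or.inr h2, ⟨le_rfl, zero_le_one⟩, h1, by simp⟩
    · rintro ⟨h, ⟨h0, h1⟩, h2, h3⟩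
      rcases h0.eq_or_lt with rfl | h0
      · exact Or.inr ⟨rfl, h2, h.resolve_left (lt_irrefl _)⟩
      · exact Or.inl ⟨h0, h1, mul_left_cancel₀ h0.ne' h3⟩

instance : LocallyCompactSpace T := isLocallyClosed.locallyCompactSpace

theorem curveHeight_param_succ (c : ℝ) (hc : -(Real.pi / 2) ≤ c) (n : ℕ) :
    curveHeight (param c hc (n + 1)) = curveHeight (param c hc n) + 1 := by
  have h : 1 / (param c hc (n + 1) : ℝ) / (2 * Real.pi) =
      1 / (param c hc n : ℝ) / (2 * Real.pi) + 1 := by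
    simp only [param, one_div_one_div]
    push_cast
    field_simp
    ring
  rw [curveHeight, h, staircase_eq, Int.fract_add_one, Int.floor_add_one, curveHeight,
    staircase_eq]
  push_cast
  ring

/-! ### The class separating the two slices -/

open AlexanderSpanier

/-- The class of degree one on `T × T` distinguishing the two slices. -/
noncomputable def minHeightClass (G : Type*) [AddCommGroupWithOne G] : H (T × T) G 1 :=
  cohomologyClass _ (delta_roundCochain_mem_locallyZero G nearlyContinuousModInt_minHeight)

theorem map_sPoint_minHeightClass (G : Type*) [AddCommGroupWithOne G] :
    H.map G (sliceEmbedding T sPoint) 1 (minHeightClass G) = 0 := by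
  refine map_cohomologyClass_roundCochain_eq_zero _ nearlyContinuousModInt_minHeight
    fun a b => ?_
  change minHeight (a, sPoint) = minHeight (b, sPoint)
  rw [minHeight_sPoint, minHeight_sPoint]

theorem map_rPoint_minHeightClass_ne_zero (G : Type*) [AddCommGroupWithOne G]
    (h1 : (1 : G) ≠ 0) : H.map G (sliceEmbedding T rPoint) 1 (minHeightClass G) ≠ 0 := by
  rw [minHeightClass, ne_eq, map_cohomologyClass_eq_zero_iff]
  rintro ⟨ψ, hψ⟩
  let g : T → G := fun a => ψ fun _ => a
  have hloc : ∀ a, ∃ U ∈ 𝓝 a, ∀ b ∈ U, ∀ c ∈ U,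
      g c - g b = ((round (minHeight (c, rPoint) - minHeight (b, rPoint)) : ℤ) : G) := by
    intro a
    obtain ⟨U, hU, h⟩ := hψ a
    refine ⟨U, hU, fun b hb c hc => ?_⟩
    have := h ![b, c] (by simp [Fin.forall_fin_two, hb, hc])
    have hd : delta T G 0 ψ ![b, c] = g c - g b := by
      change ∑ i : Fin 2, (-1 : ℤ) ^ (i : ℕ) • ψ (fun j => ![b, c] (i.succAbove j)) = _
      have e0 : (fun j : Fin 1 => ![b, c] ((0 : Fin 2).succAbove j)) = fun _ => c := by
        funext j; fin_cases j; rfl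
      have e1 : (fun j : Fin 1 => ![b, c] ((1 : Fin 2).succAbove j)) = fun _ => b := by
        funext j; fin_cases j; rfl
      rw [Fin.sum_univ_two, e0, e1]
      simp [g, sub_eq_add_neg]
    rw [Pi.add_apply, Pi.neg_apply, hd, neg_add_eq_zero] at this
    exact this
  -- The height is continuous along the graph, so nearby differences round to 0.
  have hconst : IsLocallyConstant fun x => g (graphPoint x) := by
    rw [IsLocallyConstant.iff_eventually_eq]
    intro x
    obtain ⟨U, hU, h⟩ := hloc (graphPoint x)
    have hx : (0 : ℝ) < x := x.2.1
    have hc : ContinuousAt (fun y : Set.Ioc (0 : ℝ) 1 => curveHeight y) x :=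
      (continuousAt_curveHeight hx.ne').comp (f := Subtype.val) continuous_subtype_val.continuousAt
    filter_upwards [continuous_graphPoint.continuousAt hU,
      Metric.continuousAt_iff'.1 hc (1 / 2) (by norm_num)] with y hyU hy
    have := h _ (mem_of_mem_nhds hU) _ hyU
    rw [minHeight_graphPoint_rPoint, minHeight_graphPoint_rPoint,
      round_eq_of_abs_sub_lt (n := 0) (by simpa [Real.dist_eq] using hy)] at this
    simpa [sub_eq_zero] using this
  obtain ⟨U, hU, h⟩ := hloc rPoint
  have ht : Tendsto (fun n => graphPoint (param (-(Real.pi / 2)) le_rfl n)) atTop (𝓝 rPoint) :=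
    tendsto_graphPoint_param rfl _ _ (by simp [rPoint])
  obtain ⟨n, hn⟩ := (ht.eventually hU).exists_forall_of_atTop
  -- Both valley bottoms lie in `U`, though the arc of the graph joining them climbs a peak, so the
  -- cocycle equals 1 on this pair.
  have := h _ (hn n le_rfl) _ (hn (n + 1) n.le_succ)
  rw [minHeight_graphPoint_rPoint, minHeight_graphPoint_rPoint, curveHeight_param_succ,
    add_sub_cancel_left] at this
  have hg := hconst.apply_eq_of_preconnectedSpace (param (-(Real.pi / 2)) le_rfl (n + 1))
    (param (-(Real.pi / 2)) le_rfl n)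
  rw [hg, sub_self] at this
  simp only [round_one, Int.cast_one] at this
  exact h1 this.symm

theorem map_rPoint_ne_map_sPoint (G : Type*) [AddCommGroupWithOne G] (h1 : (1 : G) ≠ 0) :
    H.map G (sliceEmbedding T rPoint) 1 ≠ H.map G (sliceEmbedding T sPoint) 1 := fun h =>
  map_rPoint_minHeightClass_ne_zero G h1 (by rw [h, map_sPoint_minHeightClass])

end modifiedSineCurve

theorem theorem2 (p : ℕ) [Fact p.Prime] :
    -- existence of locally compact (Hausdorff) connected spaces and two points
    (∃ (X T : Type) (_ : TopologicalSpace X) (_ : TopologicalSpace T) (r s : T),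
      T2Space X ∧ LocallyCompactSpace X ∧ ConnectedSpace X ∧
      T2Space T ∧ LocallyCompactSpace T ∧ ConnectedSpace T ∧
      ∃ n : ℕ, AlexanderSpanier.H.map (ZMod p) (sliceEmbedding X r) n ≠
        AlexanderSpanier.H.map (ZMod p) (sliceEmbedding X s) n) ∧
    -- the explicit example `X = T`, the modified topologist's sine curve, in degree one
    (LocallyCompactSpace modifiedSineCurve ∧ ConnectedSpace modifiedSineCurve ∧
      AlexanderSpanier.H.map (ZMod p) (sliceEmbedding modifiedSineCurve rPoint) 1 ≠
        AlexanderSpanier.H.map (ZMod p) (sliceEmbedding modifiedSineCurve sPoint) 1) := by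
  have hne := modifiedSineCurve.map_rPoint_ne_map_sPoint (ZMod p) one_ne_zero
  exact ⟨⟨modifiedSineCurve, modifiedSineCurve, inferInstance, inferInstance, rPoint, sPoint,
    inferInstance, inferInstance, inferInstance, inferInstance, inferInstance, inferInstance,
    1, hne⟩, inferInstance, inferInstance, hne⟩
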